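/- Let $n\ge 4$ be even. The $1\times n$ Dots-and-Boxes board consists of two rows of $n+1$ dots each, so that there are $n$ unit boxes. Two players alternately draw a not yet drawn edge joining two neighboring dots; a player who draws the last missing side of one or more boxes claims all boxes completed in this way and must move again. The game ends when all $n$ boxes have been completed, and a player's score is the number of boxes claimed by that player. In the open game no edge is drawn at the beginning; in the closed game the $n$ top edges and the two exterior side edges are already drawn before the first move. Then in both the closed and the open $1\times n$ game the first player can guarantee at least a tie: the first player has a strategy which ensures, whatever the second player does, that at the end of the game the first player has claimed at least as many boxes as the second player. -/

import Mathlib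

namespace NarrowBoxes

/-- The two players. -/
inductive Player
  | first
  | second
  deriving DecidableEq

/-- The opponent of a player. -/
def Player.other : Player → Player
  | .first => .second
  | .second => .first

/-- The edges of the `1 × n` board, which has two rows of `n + 1` dots each: `top i` and `bottom i`
join the `i`-th and `(i+1)`-st dot of the upper (lower) row, and `vert j` joins the `j`-th dot of
the upper row to the `j`-th dot of the lower row. -/
inductive Edge (n : ℕ)
  | top (i : Fin n)
  | bottom (i : Fin n)
  | vert (j : Fin (n + 1))
  deriving DecidableEq

/-- The four sides of the `i`-th box. -/
def sides {n : ℕ} (i : Fin n) : Finset (Edge n) :=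
  {Edge.top i, Edge.bottom i, Edge.vert i.castSucc, Edge.vert i.succ}

/-- A position of the game: the edges drawn so far, the player who has to move, and the number of
boxes claimed so far by each player. -/
structure Position (n : ℕ) where
  drawn : Finset (Edge n)
  turn : Player
  score : Player → ℕ

/-- The game is over when all boxes have been completed. -/
def Position.IsOver {n : ℕ} (p : Position n) : Prop :=
  ∀ i : Fin n, sides i ⊆ p.drawn

/-- The boxes that are completed by drawing the edge `e`. -/
def Position.completedBy {n : ℕ} (p : Position n) (e : Edge n) : Finset (Fin n) :=
  {i : Fin n | ¬ sides i ⊆ p.drawn ∧ sides i ⊆ insert e p.drawn}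

/-- The position after the player to move has drawn the edge `e`: that player claims every box
completed by `e`, and moves again if there is one; otherwise the turn passes to the opponent. -/
def Position.draw {n : ℕ} (p : Position n) (e : Edge n) : Position n where
  drawn := insert e p.drawn
  turn := if (p.completedBy e).Nonempty then p.turn else p.turn.other
  score := Function.update p.score p.turn (p.score p.turn + (p.completedBy e).card)

/-- A strategy of the player `A` prescribes a move, that is, an edge not drawn yet, in each
position in which the game is not over and `A` has to move (other values are irrelevant). -/
def IsStrategy {n : ℕ} (A : Player) (σ : Position n → Edge n) : Prop :=
  ∀ p : Position n, ¬ p.IsOver → p.turn = A → σ p ∉ p.drawn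

/-- `q` results from `p` by one legal move, which is the one prescribed by `σ` if it is `A`'s. -/
def Step {n : ℕ} (A : Player) (σ : Position n → Edge n) (p q : Position n) : Prop :=
  ¬ p.IsOver ∧ ∃ e : Edge n, e ∉ p.drawn ∧ (p.turn = A → e = σ p) ∧ q = p.draw e

/-- The player `A` can guarantee (at least) a tie from the position `s`: `A` has a strategy such
that, however the opponent plays, at the end of the game `A` has claimed at least as many boxes as
the opponent. -/
def CanGuaranteeTie {n : ℕ} (A : Player) (s : Position n) : Prop :=
  ∃ σ : Position n → Edge n, IsStrategy A σ ∧
    ∀ q : Position n, Relation.ReflTransGen (Step A σ) s q → q.IsOver →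
      q.score A.other ≤ q.score A

/-- The open game begins with no edge drawn. -/
def openStart (n : ℕ) : Position n where
  drawn := ∅
  turn := .first
  score := fun _ => 0

/-- The closed game begins with the top edges and the two side exterior edges drawn. -/
def closedStart (n : ℕ) : Position n where
  drawn := insert (Edge.vert 0) (insert (Edge.vert (Fin.last n)) (Finset.univ.image Edge.top))
  turn := .first
  score := fun _ => 0

end NarrowBoxes

namespace NarrowBoxes

open Finset

variable {n : ℕ}

/-! ### Geometry of the board -/

/-! The first player opens with the middle vertical edge and then plays by reflection. The invariant
is a symmetric position that contains the middle edge and in which no box misses exactly one side;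
whoever has to move there cannot win (`value_nonpos_of_symmetric`). That player can only draw some
`e` that completes nothing. If this offers two boxes to be taken one after the other, the opponent
may take both or decline them, and one of the two choices does not lose (`value_nonneg_of_run`).
Otherwise the opponent takes all that is offered and draws the mirror image of `e`. Taking the
mirrored boxes is then an optimal reply (`value_le_add_value_union`), the gains cancel, and the
invariant is restored. All this is phrased with the minimax `value`;
`canGuaranteeTie_of_value_nonneg` turns it into a strategy. -/

theorem mem_sides {i : Fin n} {e : Edge n} :
    e ∈ sides i ↔
      e = Edge.top i ∨ e = Edge.bottom i ∨ e = Edge.vert i.castSucc ∨ e = Edge.vert i.succ := by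
  simp [sides]

theorem eq_vert_of_mem_sides_of_lt {i j : Fin n} {e : Edge n} (hi : e ∈ sides i)
    (hj : e ∈ sides j) (hij : i < j) : (j : ℕ) = i + 1 ∧ e = Edge.vert j.castSucc := by
  rw [mem_sides] at hi hj
  rw [Fin.lt_def] at hij
  rcases hi with rfl | rfl | rfl | rfl <;>
    simp only [Edge.top.injEq, Edge.bottom.injEq, Edge.vert.injEq, reduceCtorEq, Fin.ext_iff,
      Fin.val_castSucc, Fin.val_succ, false_or, or_false] at hj ⊢ <;> omega

theorem adjacent_of_mem_sides {i j : Fin n} {e : Edge n} (hi : e ∈ sides i) (hj : e ∈ sides j)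
    (hij : i ≠ j) : (j : ℕ) = i + 1 ∨ (i : ℕ) = j + 1 := by
  rcases lt_or_gt_of_ne hij with h | h
  · exact Or.inl (eq_vert_of_mem_sides_of_lt hi hj h).1
  · exact Or.inr (eq_vert_of_mem_sides_of_lt hj hi h).1

/-- Three different boxes do not pairwise share sides. -/
theorem no_triangle {i j k : Fin n} {e f g : Edge n} (hij : i ≠ j) (hjk : j ≠ k) (hik : i ≠ k)
    (hei : e ∈ sides i) (hej : e ∈ sides j) (hfj : f ∈ sides j) (hfk : f ∈ sides k)
    (hgi : g ∈ sides i) (hgk : g ∈ sides k) : False := by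
  have h1 := adjacent_of_mem_sides hei hej hij
  have h2 := adjacent_of_mem_sides hfj hfk hjk
  have h3 := adjacent_of_mem_sides hgi hgk hik
  omega

theorem exists_mem_sides (hn : 0 < n) (e : Edge n) : ∃ i, e ∈ sides i := by
  cases e with
  | top i => exact ⟨i, by simp [mem_sides]⟩
  | bottom i => exact ⟨i, by simp [mem_sides]⟩
  | vert j =>
    by_cases h : (j : ℕ) < n
    · exact ⟨⟨j, h⟩, by simp [mem_sides, Fin.ext_iff]⟩
    · refine ⟨⟨n - 1, by omega⟩, ?_⟩
      simp only [mem_sides, reduceCtorEq, Edge.vert.injEq, Fin.ext_iff, Fin.val_succ, false_or]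
      have := j.isLt
      right
      omega

noncomputable instance : Fintype (Edge n) :=
  Fintype.ofSurjective
    (fun x : Fin n ⊕ Fin n ⊕ Fin (n + 1) =>
      x.elim Edge.top fun y => y.elim Edge.bottom Edge.vert)
    fun e => by
      cases e with
      | top i => exact ⟨Sum.inl i, rfl⟩
      | bottom i => exact ⟨Sum.inr (Sum.inl i), rfl⟩
      | vert j => exact ⟨Sum.inr (Sum.inr j), rfl⟩

/-- The reflection of the board that exchanges left and right. -/
def mirror : Edge n → Edge n
  | .top i => .top i.rev
  | .bottom i => .bottom i.rev
  | .vert j => .vert j.rev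

@[simp] theorem mirror_mirror (e : Edge n) : mirror (mirror e) = e := by
  cases e <;> simp [mirror]

theorem mirror_mem_sides_rev {i : Fin n} {e : Edge n} (h : e ∈ sides i) :
    mirror e ∈ sides i.rev := by
  rw [mem_sides] at h ⊢
  rcases h with rfl | rfl | rfl | rfl <;> simp [mirror, Fin.rev_castSucc, Fin.rev_succ]

theorem mirror_mem_sides {i : Fin n} {e : Edge n} (h : mirror e ∈ sides i) : e ∈ sides i.rev := by
  simpa using mirror_mem_sides_rev h

theorem sides_rev_subset_image_mirror {i : Fin n} {D : Finset (Edge n)} (h : sides i ⊆ D) :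
    sides i.rev ⊆ D.image mirror := by
  intro e he
  have h1 := mirror_mem_sides_rev he
  rw [Fin.rev_rev] at h1
  exact mem_image.2 ⟨_, h h1, mirror_mirror e⟩

theorem image_mirror_image_mirror (D : Finset (Edge n)) : (D.image mirror).image mirror = D := by
  rw [image_image]
  have : (mirror ∘ mirror : Edge n → Edge n) = id := funext mirror_mirror
  rw [this, image_id]

/-! ### Completed boxes -/

/-- The number of completed boxes. -/
def completed (D : Finset (Edge n)) : ℤ := (univ.filter fun i : Fin n => sides i ⊆ D).card

theorem completedBoxes_mono {D E : Finset (Edge n)} (h : D ⊆ E) :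
    (univ.filter fun i : Fin n => sides i ⊆ D) ⊆ univ.filter fun i : Fin n => sides i ⊆ E := by
  intro i hi
  simp only [mem_filter, mem_univ, true_and] at hi ⊢
  exact hi.trans h

theorem completed_mono {D E : Finset (Edge n)} (h : D ⊆ E) : completed D ≤ completed E := by
  unfold completed
  exact_mod_cast card_le_card (completedBoxes_mono h)

theorem completed_eq {D E : Finset (Edge n)} (h : D ⊆ E)
    (hE : ∀ i : Fin n, sides i ⊆ E → sides i ⊆ D) : completed E = completed D := by
  unfold completed
  congr 2
  ext i
  simpa using ⟨hE i, fun hi => hi.trans h⟩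

theorem completed_lt {D E : Finset (Edge n)} (h : D ⊆ E) {i : Fin n} (hD : ¬ sides i ⊆ D)
    (hE : sides i ⊆ E) : completed D < completed E := by
  unfold completed
  exact_mod_cast card_lt_card ⟨completedBoxes_mono h,
    fun hs => hD (by simpa using hs (show i ∈ _ by simpa using hE))⟩

theorem Position.card_completedBy (p : Position n) (e : Edge n) :
    ((p.completedBy e).card : ℤ) = completed (insert e p.drawn) - completed p.drawn := by
  have h : p.completedBy e = (univ.filter fun i : Fin n => sides i ⊆ insert e p.drawn) \
      (univ.filter fun i : Fin n => sides i ⊆ p.drawn) := by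
    ext i
    simp [Position.completedBy, and_comm]
  rw [h, cast_card_sdiff (completedBoxes_mono (subset_insert _ _))]
  rfl

theorem completed_image_mirror (D : Finset (Edge n)) :
    completed (D.image mirror) = completed D := by
  unfold completed
  congr 1
  refine card_bij' (fun i _ => i.rev) (fun i _ => i.rev) ?_ ?_ ?_ ?_
  · intro i hi
    simp only [mem_filter, mem_univ, true_and] at hi ⊢
    simpa [image_mirror_image_mirror] using sides_rev_subset_image_mirror hi
  · intro i hi
    simp only [mem_filter, mem_univ, true_and] at hi ⊢
    exact sides_rev_subset_image_mirror hi
  · simp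
  · simp

/-- Each box meets only one of `A` and `B`, so the other set does not affect whether it is complete,
and the gains add box by box. -/
theorem completed_union_union {D A B : Finset (Edge n)}
    (h : ∀ i : Fin n, Disjoint (sides i) A ∨ Disjoint (sides i) B) :
    completed (D ∪ A ∪ B) + completed D = completed (D ∪ A) + completed (D ∪ B) := by
  unfold completed
  simp only [card_filter]
  push_cast
  rw [← sum_add_distrib, ← sum_add_distrib]
  refine sum_congr rfl fun i _ => ?_
  rcases h i with hi | hi
  · have h1 : sides i ⊆ D ∪ A ↔ sides i ⊆ D :=
      ⟨fun h => hi.left_le_of_le_sup_right h, fun h => h.trans subset_union_left⟩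
    have h2 : sides i ⊆ D ∪ A ∪ B ↔ sides i ⊆ D ∪ B := by
      rw [union_right_comm]
      exact ⟨fun h => hi.left_le_of_le_sup_right h, fun h => h.trans subset_union_left⟩
    simp only [h1, h2]
    ring
  · have h1 : sides i ⊆ D ∪ B ↔ sides i ⊆ D :=
      ⟨fun h => hi.left_le_of_le_sup_right h, fun h => h.trans subset_union_left⟩
    have h2 : sides i ⊆ D ∪ A ∪ B ↔ sides i ⊆ D ∪ A :=
      ⟨fun h => hi.left_le_of_le_sup_right h, fun h => h.trans subset_union_left⟩
    simp only [h1, h2]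

/-! ### The value of a position -/

/-- The greatest margin by which the player to move can win the rest of the game. -/
noncomputable def value (D : Finset (Edge n)) : ℤ :=
  if h : Dᶜ.Nonempty then
    Dᶜ.attach.sup' (attach_nonempty_iff.2 h) fun e =>
      if completed (insert e.1 D) = completed D then -value (insert e.1 D)
      else completed (insert e.1 D) - completed D + value (insert e.1 D)
  else 0
termination_by Dᶜ.card
decreasing_by
  all_goals
    refine card_lt_card (compl_ssubset_compl.2 (ssubset_insert ?_))
    exact mem_compl.1 e.2

/-- The margin obtained by drawing `e`. -/
noncomputable def margin (D : Finset (Edge n)) (e : Edge n) : ℤ :=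
  if completed (insert e D) = completed D then -value (insert e D)
  else completed (insert e D) - completed D + value (insert e D)

theorem value_univ : value (univ : Finset (Edge n)) = 0 := by
  rw [value]
  simp

theorem margin_le_value {D : Finset (Edge n)} {e : Edge n} (he : e ∉ D) :
    margin D e ≤ value D := by
  have h : Dᶜ.Nonempty := ⟨e, mem_compl.2 he⟩
  rw [value, dif_pos h]
  exact le_sup' (fun e : {x // x ∈ Dᶜ} => margin D e.1) (mem_attach _ ⟨e, mem_compl.2 he⟩)

theorem exists_margin_eq_value {D : Finset (Edge n)} (hD : D ≠ univ) :
    ∃ e ∉ D, margin D e = value D := by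
  have h : Dᶜ.Nonempty := by rwa [nonempty_iff_ne_empty, Ne, compl_eq_empty_iff]
  obtain ⟨e, -, he⟩ := exists_mem_eq_sup' (attach_nonempty_iff.2 h)
    (fun e : {x // x ∈ Dᶜ} => margin D e.1)
  refine ⟨e.1, mem_compl.1 e.2, ?_⟩
  rw [← he]
  conv_rhs => rw [value, dif_pos h]
  rfl

theorem neg_value_le {D : Finset (Edge n)} {e : Edge n} (he : e ∉ D)
    (hc : completed (insert e D) = completed D) : -value (insert e D) ≤ value D := by
  have := margin_le_value he
  rwa [margin, if_pos hc] at this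

theorem add_value_le {D : Finset (Edge n)} {e : Edge n} (he : e ∉ D)
    (hc : completed D < completed (insert e D)) :
    completed (insert e D) - completed D + value (insert e D) ≤ value D := by
  have := margin_le_value he
  rwa [margin, if_neg hc.ne'] at this

theorem value_le {D : Finset (Edge n)} {m : ℤ} (h0 : D = univ → 0 ≤ m)
    (h1 : ∀ e ∉ D, completed (insert e D) = completed D → -value (insert e D) ≤ m)
    (h2 : ∀ e ∉ D, completed D < completed (insert e D) →
      completed (insert e D) - completed D + value (insert e D) ≤ m) : value D ≤ m := by
  by_cases hD : D = univ
  · rw [hD, value_univ]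
    exact h0 hD
  · obtain ⟨e, he, hv⟩ := exists_margin_eq_value hD
    rw [← hv, margin]
    split_ifs with hc
    · exact h1 e he hc
    · exact h2 e he (lt_of_le_of_ne (completed_mono (subset_insert _ _)) (Ne.symm hc))

/-- Taking all the boxes that can be taken at once is an option. -/
theorem add_value_union_le (K : Finset (Edge n)) {D : Finset (Edge n)}
    (hK : ∀ k ∈ K, ∃ i : Fin n, k ∈ sides i ∧ sides i ⊆ insert k D) :
    completed (D ∪ K) - completed D + value (D ∪ K) ≤ value D := by
  induction K using Finset.induction_on generalizing D with
  | empty => simp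
  | insert k K _ ih =>
    have h := @ih (insert k D) fun l hl => by
      obtain ⟨i, hi, hs⟩ := hK l (mem_insert_of_mem hl)
      exact ⟨i, hi, hs.trans (insert_subset_insert _ (subset_insert _ _))⟩
    have hu : D ∪ insert k K = insert k D ∪ K := by rw [union_insert, insert_union]
    rw [hu]
    by_cases hk : k ∈ D
    · rwa [insert_eq_of_mem hk] at h ⊢
    · obtain ⟨i, hi, hs⟩ := hK k (mem_insert_self _ _)
      have := add_value_le hk (completed_lt (subset_insert _ _) (fun h => hk (h hi)) hs)
      linarith

/-- If no box misses exactly one side once those that can be taken at once are taken, then it is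
optimal to take them. -/
theorem value_le_add_value_union {K D : Finset (Edge n)}
    (hK : ∀ k ∈ K, ∃ i : Fin n, k ∈ sides i ∧ sides i ⊆ insert k D)
    (hs : ∀ (i : Fin n) (f : Edge n), sides i ⊆ insert f (D ∪ K) → sides i ⊆ D ∪ K) :
    value D ≤ completed (D ∪ K) - completed D + value (D ∪ K) := by
  induction hm : (K \ D).card using Nat.strong_induction_on generalizing D with
  | _ m ih =>
  have hmono := completed_mono (n := n) (subset_union_left : D ⊆ D ∪ K)
  have key : ∀ f ∉ D, f ∈ K → value (insert f D) ≤
      completed (D ∪ K) - completed (insert f D) + value (D ∪ K) := by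
    intro f hf hfK
    have hu : insert f D ∪ K = D ∪ K := by
      rw [insert_union, insert_eq_of_mem (mem_union_right _ hfK)]
    have := ih ((K \ insert f D).card) (by
      rw [← hm]
      refine card_lt_card ⟨sdiff_subset_sdiff Subset.rfl (subset_insert _ _), fun h => ?_⟩
      simpa using h (mem_sdiff.2 ⟨hfK, hf⟩)) (D := insert f D) (fun k hk => by
        obtain ⟨i, hi, hsi⟩ := hK k hk
        exact ⟨i, hi, hsi.trans (insert_subset_insert _ (subset_insert _ _))⟩)
      (by rwa [hu]) rfl
    rwa [hu] at this
  refine value_le ?_ ?_ ?_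
  · rintro rfl
    rw [union_eq_left.2 (subset_univ K), value_univ]
    simp
  · intro f hf hc
    have hfK : f ∉ K := fun hfK => by
      obtain ⟨i, hi, hsi⟩ := hK f hfK
      exact (completed_lt (subset_insert _ _) (fun h => hf (h hi)) hsi).ne' hc
    -- After `f` the opponent may take all of `K`; taking `K` first and then drawing `f` reaches the
    -- same position with the same player to move, but keeps the boxes.
    have h1 := add_value_union_le K (D := insert f D) fun k hk => by
      obtain ⟨i, hi, hsi⟩ := hK k hk
      exact ⟨i, hi, hsi.trans (insert_subset_insert _ (subset_insert _ _))⟩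
    have h2 := neg_value_le (D := D ∪ K) (e := f) (by simp [hf, hfK])
      (completed_eq (subset_insert _ _) fun i hi => hs i f hi)
    rw [← insert_union] at h2
    have h3 := completed_mono (n := n) (subset_union_left : insert f D ⊆ insert f D ∪ K)
    linarith
  · intro f hf hc
    by_cases hfK : f ∈ K
    · linarith [key f hf hfK]
    · exfalso
      refine hc.ne' (completed_eq (subset_insert _ _) fun i hi => ?_)
      have h1 := hs i f (hi.trans (insert_subset_insert _ subset_union_left))
      intro a ha
      rcases mem_insert.1 (hi ha) with rfl | h
      · have := h1 ha
        simp [hf, hfK] at this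
      · exact h

/-- It is optimal to take boxes that do not affect the rest of the board. -/
theorem value_le_of_isolated {D : Finset (Edge n)} {d : Edge n} (hd : d ∉ D)
    (hc : completed D < completed (insert d D))
    (h : ∀ i : Fin n, d ∈ sides i → sides i ⊆ insert d D) :
    value D ≤ completed (insert d D) - completed D + value (insert d D) := by
  induction hm : Dᶜ.card using Nat.strong_induction_on generalizing D with
  | _ m ih =>
  -- Boxes at `d` have no other missing side, so `f` and `d` concern different boxes.
  have hcount : ∀ f ∉ D, f ≠ d → completed (insert f (insert d D)) - completed (insert d D) =
      completed (insert f D) - completed D := by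
    intro f hf hfd
    have := completed_union_union (D := D) (A := {f}) (B := {d}) fun i => by
      by_cases hi : d ∈ sides i
      · refine Or.inl (disjoint_singleton_right.2 fun hfi => ?_)
        rcases mem_insert.1 (h i hi hfi) with h1 | h1
        exacts [hfd h1, hf h1]
      · exact Or.inr (disjoint_singleton_right.2 hi)
    simp only [union_singleton, Finset.insert_comm d f] at this
    linarith
  refine value_le ?_ ?_ ?_
  · rintro rfl
    simp at hd
  · intro f hf hcf
    have hfd : f ≠ d := by
      rintro rfl
      exact hc.ne' hcf
    have h1 := hcount f hf hfd
    have h2 := neg_value_le (D := insert d D) (e := f) (by simp [hf, hfd]) (by linarith)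
    have h3 := add_value_le (D := insert f D) (e := d) (by simp [hd, hfd.symm])
      (by rw [Finset.insert_comm d f]; linarith)
    rw [Finset.insert_comm d f] at h3
    linarith
  · intro f hf hcf
    by_cases hfd : f = d
    · rw [hfd]
    have h1 := hcount f hf hfd
    have h2 := add_value_le (D := insert d D) (e := f) (by simp [hf, hfd]) (by linarith)
    have h3 := ih ((insert f D)ᶜ.card)
      (by rw [← hm]; exact card_lt_card (compl_ssubset_compl.2 (ssubset_insert hf)))
      (D := insert f D) (by simp [hd, Ne.symm hfd]) (by rw [Finset.insert_comm d f]; linarith)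
      (fun i hi => (h i hi).trans (insert_subset_insert _ (subset_insert _ _))) rfl
    rw [Finset.insert_comm d f] at h3
    linarith

/-- If two adjacent boxes can be taken one after the other, then the player to move does not lose:
this player takes both or leaves both to the opponent by drawing the far side of the second. -/
theorem value_nonneg_of_run {D : Finset (Edge n)} {x y : Fin n} {g f : Edge n}
    (hg : g ∉ D) (hf : f ∉ D) (hfg : f ≠ g) (hgx : g ∈ sides x) (hgy : g ∈ sides y)
    (hfy : f ∈ sides y) (hx : sides x ⊆ insert g D) (hy : sides y ⊆ insert f (insert g D))
    (hcf : completed (insert f D) = completed D) : 0 ≤ value D := by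
  have hxy : x ≠ y := by
    rintro rfl
    rcases mem_insert.1 (hx hfy) with h | h
    exacts [hfg h, hf h]
  -- With `V` the value once `f` and `g` are drawn, taking both boxes gives at least `2 + V`, and
  -- declining gives at least `-2 - V`. These bounds add up to `0`.
  have h1 := add_value_le hg (completed_lt (subset_insert _ _) (fun h => hg (h hgx)) hx)
  have h2 := add_value_le (D := insert g D) (e := f) (by simp [hf, hfg])
    (completed_lt (i := y) (subset_insert _ _)
      (fun h => by simpa [hf, hfg] using h hfy) hy)
  have hx' : sides x ⊆ insert g (insert f D) :=
    hx.trans (insert_subset_insert _ (subset_insert _ _))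
  have hy' : sides y ⊆ insert g (insert f D) := by rwa [Finset.insert_comm]
  have h3 := neg_value_le hf hcf
  have h4 := value_le_of_isolated (D := insert f D) (d := g) (by simp [hg, hfg.symm])
    (completed_lt (subset_insert _ _) (fun h => by simpa [hg, hfg.symm] using h hgx) hx')
    fun z hz => by
      by_cases hzx : z = x
      · rwa [hzx]
      by_cases hzy : z = y
      · rwa [hzy]
      exact (no_triangle hzx hxy hzy hz hgx hgx hgy hz hgy).elim
  have h5 : completed (insert g (insert f D)) ≤ completed D + 2 := by
    have hsub : (univ.filter fun i : Fin n => sides i ⊆ insert g (insert f D)) ⊆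
        insert x (insert y (univ.filter fun i : Fin n => sides i ⊆ D)) := by
      intro z hz
      simp only [mem_filter, mem_univ, true_and, mem_insert] at hz ⊢
      by_contra! hne
      have hgz : g ∉ sides z := fun hz' =>
        no_triangle hne.1 hxy hne.2.1 hz' hgx hgx hgy hz' hgy
      have hz1 : sides z ⊆ insert f D := fun a ha => by
        rcases mem_insert.1 (hz ha) with rfl | h
        exacts [(hgz ha).elim, h]
      exact (completed_lt (subset_insert _ _) hne.2.2 hz1).ne' hcf
    have := (card_le_card hsub).trans ((card_insert_le _ _).trans
      (Nat.add_le_add_right (card_insert_le _ _) 1))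
    unfold completed
    exact_mod_cast this
  have h6 : completed D + 2 ≤ completed (insert f (insert g D)) := by
    have a := completed_lt (subset_insert g D) (fun h => hg (h hgx)) hx
    have b := completed_lt (subset_insert f (insert g D)) (i := y)
      (fun h => by simpa [hf, hfg] using h hfy) hy
    linarith
  rw [Finset.insert_comm g f] at h4 h5
  linarith

/-! ### Symmetric positions -/

/-- No box misses exactly one side. -/
def Stable (D : Finset (Edge n)) : Prop :=
  ∀ (i : Fin n) (f : Edge n), sides i ⊆ insert f D → sides i ⊆ D

theorem Stable.completed_insert {D : Finset (Edge n)} (h : Stable D) (f : Edge n) :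
    completed (insert f D) = completed D :=
  completed_eq (subset_insert _ _) fun i hi => h i f hi

theorem Stable.image_mirror {D : Finset (Edge n)} (h : Stable D) : Stable (D.image mirror) := by
  intro i f hi
  have h1 := sides_rev_subset_image_mirror hi
  rw [image_insert, image_mirror_image_mirror] at h1
  simpa using sides_rev_subset_image_mirror (h _ _ h1)

theorem Stable.union_union {D A B : Finset (Edge n)} (hA : Stable (D ∪ A)) (hB : Stable (D ∪ B))
    (h : ∀ i : Fin n, Disjoint (sides i) A ∨ Disjoint (sides i) B) : Stable (D ∪ A ∪ B) := by
  intro i f hi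
  rcases h i with hd | hd
  · rw [union_right_comm, ← insert_union] at hi
    rw [union_right_comm]
    exact (hB i f (hd.left_le_of_le_sup_right hi)).trans subset_union_left
  · rw [← insert_union] at hi
    exact (hA i f (hd.left_le_of_le_sup_right hi)).trans subset_union_left

/-- The vertical edge in the middle of the board, for even `n`. -/
def middle (n : ℕ) : Edge n := Edge.vert ⟨n / 2, by omega⟩

theorem mirror_middle (heven : Even n) : mirror (middle n) = middle n := by
  obtain ⟨m, rfl⟩ := heven
  simp only [mirror, middle, Edge.vert.injEq, Fin.ext_iff, Fin.val_rev]
  omega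

/-- The boxes on both sides of an edge other than the middle one lie in the same half of the board. -/
theorem lt_half_iff {i j : Fin n} {e : Edge n} (he : e ≠ middle n) (hi : e ∈ sides i)
    (hj : e ∈ sides j) : (i : ℕ) < n / 2 ↔ (j : ℕ) < n / 2 := by
  have key : ∀ {i j : Fin n}, e ∈ sides i → e ∈ sides j → i < j →
      ((i : ℕ) < n / 2 ↔ (j : ℕ) < n / 2) := by
    intro i j hi hj hij
    obtain ⟨h1, rfl⟩ := eq_vert_of_mem_sides_of_lt hi hj hij
    have : (j : ℕ) ≠ n / 2 := fun h => he (by simp [middle, Fin.ext_iff, h])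
    omega
  rcases lt_trichotomy i j with h | h | h
  · exact key hi hj h
  · rw [h]
  · exact (key hj hi h).symm

theorem rev_lt_half_iff (heven : Even n) (i : Fin n) :
    (i.rev : ℕ) < n / 2 ↔ ¬ (i : ℕ) < n / 2 := by
  obtain ⟨m, rfl⟩ := heven
  rw [Fin.val_rev]
  omega

/-- The middle edge separates the halves: a move and the captures it offers stay in one half, so
their reflections do not interfere with them. Induction on the number of undrawn edges. -/
theorem value_nonpos_of_symmetric (heven : Even n) (hpos : 0 < n) {D : Finset (Edge n)}
    (hmid : middle n ∈ D) (hsym : D.image mirror = D) (hst : Stable D) : value D ≤ 0 := by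
  induction hm : Dᶜ.card using Nat.strong_induction_on generalizing D with
  | _ m ih =>
  refine value_le (fun _ => le_rfl) ?_ fun e _ hc => (hc.ne' (hst.completed_insert e)).elim
  intro e he hce
  rw [neg_nonpos]
  set E := insert e D with hE
  have hDE : D ⊆ E := subset_insert _ _
  -- By stability of `D`, only boxes at `e` can now miss a single side.
  have hclose : ∀ {x : Fin n} {g : Edge n}, g ∉ E → g ∈ sides x → sides x ⊆ insert g E →
      e ∈ sides x := by
    intro x g hg hgx hx
    by_contra hex
    refine hg (hDE (hst x g (fun a ha => ?_) hgx))
    rcases mem_insert.1 (hx ha) with rfl | h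
    · exact mem_insert_self _ _
    · rcases mem_insert.1 h with rfl | h
      exacts [(hex ha).elim, mem_insert_of_mem h]
  by_cases hrun : ∃ (g f : Edge n) (x y : Fin n), g ∉ E ∧ f ∉ E ∧ f ≠ g ∧ g ∈ sides x ∧
      g ∈ sides y ∧ f ∈ sides y ∧ sides x ⊆ insert g E ∧ sides y ⊆ insert f (insert g E)
  · obtain ⟨g, f, x, y, hg, hf, hfg, hgx, hgy, hfy, hx, hy⟩ := hrun
    -- If `f` completed a box `z`, then `x`, `y`, `z` would pairwise share `g`, `f` and `e`.
    refine value_nonneg_of_run hg hf hfg hgx hgy hfy hx hy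
      (completed_eq (subset_insert _ _) fun z hz => ?_)
    have hfx : f ∉ sides x := fun h => by simpa [hfg, hf] using hx h
    by_contra hzE
    have hfz : f ∈ sides z := by
      by_contra hfz
      exact hzE fun a ha => (mem_insert.1 (hz ha)).resolve_left fun h => hfz (h ▸ ha)
    refine no_triangle (i := x) (j := y) (k := z) ?_ ?_ ?_ hgx hgy hfy hfz
      (hclose hg hgx hx) (hclose hf hfz hz)
    · rintro rfl
      exact hfx hfy
    · rintro rfl
      simpa [hfg.symm, hg] using hz hgy
    · rintro rfl
      exact hfx hfz
  · set K : Finset (Edge n) :=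
      univ.filter fun k => k ∉ E ∧ ∃ i : Fin n, k ∈ sides i ∧ sides i ⊆ insert k E with hKdef
    have hK : ∀ {k}, k ∈ K ↔ k ∉ E ∧ ∃ i : Fin n, k ∈ sides i ∧ sides i ⊆ insert k E := by
      intro k
      simp [hKdef]
    have hstEK : Stable (E ∪ K) := by
      intro i f hi
      by_contra hiE
      have hfi : f ∈ sides i := by
        by_contra hfi
        exact hiE fun a ha => (mem_insert.1 (hi ha)).resolve_left fun h => hfi (h ▸ ha)
      have hfEK : f ∉ E ∪ K := fun hf => hiE (by rwa [insert_eq_of_mem hf] at hi)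
      have hfE : f ∉ E := fun h => hfEK (mem_union_left _ h)
      -- Otherwise `i` misses only `f` already in `E`, which puts `f` in `K`.
      obtain ⟨g, hgi, hgK⟩ : ∃ g ∈ sides i, g ∈ K := by
        by_contra! hno
        refine hfEK (mem_union_right _ (hK.2 ⟨hfE, i, hfi, fun a ha => ?_⟩))
        have := hi ha
        simp only [mem_insert, mem_union, hno a ha, or_false] at this ⊢
        exact this
      have hfg : f ≠ g := fun h => hfEK (mem_union_right _ (h ▸ hgK))
      obtain ⟨hgE, x, hgx, hx⟩ := hK.1 hgK
      have hfx : ∀ {x : Fin n} {k : Edge n}, k ∈ K → sides x ⊆ insert k E → x ≠ i := by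
        rintro x k hk hx rfl
        rcases mem_insert.1 (hx hfi) with h | h
        exacts [hfEK (mem_union_right _ (h ▸ hk)), hfE h]
      refine hrun ⟨g, f, x, i, hgE, hfE, hfg, hgx, hgi, hfi, hx, fun a ha => ?_⟩
      have := hi ha
      simp only [mem_insert, mem_union] at this ⊢
      rcases this with h | h | h
      · exact Or.inl h
      · exact Or.inr (Or.inr h)
      -- A second side `a` of `i` in `K` would complete some `z`, and `x`, `i`, `z` would pairwise
      -- share `g`, `a` and `e`. Hence `x`, `i` form an excluded run.
      · by_contra! hne
        obtain ⟨haE, z, haz, hz⟩ := hK.1 h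
        refine no_triangle (i := x) (j := i) (k := z) (hfx hgK hx) (hfx h hz).symm ?_ hgx hgi ha
          haz (hclose hgE hgx hx) (hclose haE haz hz)
        rintro rfl
        rcases mem_insert.1 (hx haz) with h' | h'
        exacts [hne.2.1 h', haE h']
    set A := insert e K with hA
    have hEK : E ∪ K = D ∪ A := by rw [hE, hA, insert_union, union_insert]
    set B := A.image mirror with hB
    have hDB : D ∪ B = (D ∪ A).image mirror := by rw [image_union, hsym]
    obtain ⟨x₀, hx₀⟩ := exists_mem_sides hpos e
    have hne : ∀ {a}, a ∉ D → a ≠ middle n := fun ha h => ha (h ▸ hmid)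
    have hAhalf : ∀ {i : Fin n} {a : Edge n}, a ∈ A → a ∈ sides i →
        ((i : ℕ) < n / 2 ↔ (x₀ : ℕ) < n / 2) := by
      intro i a ha hai
      rcases mem_insert.1 ha with rfl | ha
      · exact lt_half_iff (hne he) hai hx₀
      · obtain ⟨haE, x, hax, hx⟩ := hK.1 ha
        exact (lt_half_iff (hne fun h => haE (hDE h)) hai hax).trans
          (lt_half_iff (hne he) (hclose haE hax hx) hx₀)
    have hsep : ∀ i : Fin n, Disjoint (sides i) A ∨ Disjoint (sides i) B := by
      intro i
      by_contra! h
      obtain ⟨a, hai, haA⟩ := not_disjoint_iff.1 h.1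
      obtain ⟨b, hbi, hbB⟩ := not_disjoint_iff.1 h.2
      obtain ⟨c, hcA, rfl⟩ := mem_image.1 hbB
      have h1 := hAhalf haA hai
      have h2 := hAhalf hcA (mirror_mem_sides hbi)
      rw [rev_lt_half_iff heven] at h2
      tauto
    have hstA : Stable (D ∪ A) := hEK ▸ hstEK
    have hstT : Stable (D ∪ A ∪ B) := hstA.union_union (hDB ▸ hstA.image_mirror) hsep
    have hcount := completed_union_union (D := D) hsep
    rw [hDB, completed_image_mirror] at hcount
    have hT : insert (mirror e) (D ∪ A) ∪ K.image mirror = D ∪ A ∪ B := by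
      rw [hB, hA, image_insert, insert_union, union_insert (mirror e)]
    have h1 := add_value_union_le K (D := E) fun k hk => (hK.1 hk).2
    rw [hEK] at h1
    have he' : mirror e ∉ D ∪ A := by
      have heB : mirror e ∈ B := mem_image_of_mem _ (mem_insert_self _ _)
      have hme : mirror e ∈ sides x₀.rev := mirror_mem_sides_rev hx₀
      intro h
      rcases mem_union.1 h with h | h
      · refine he ?_
        rw [← hsym, ← mirror_mirror e]
        exact mem_image_of_mem _ h
      · rcases hsep x₀.rev with hd | hd
        exacts [disjoint_left.1 hd hme h, disjoint_left.1 hd hme heB]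
    have h2 := neg_value_le he' (hstA.completed_insert _)
    have hc2 := hstA.completed_insert (mirror e)
    have h3 := value_le_add_value_union (K := K.image mirror) (D := insert (mirror e) (D ∪ A))
      (fun k hk => by
        obtain ⟨l, hl, rfl⟩ := mem_image.1 hk
        obtain ⟨-, i, hki, hi⟩ := hK.1 hl
        refine ⟨i.rev, mirror_mem_sides_rev hki,
          (sides_rev_subset_image_mirror hi).trans ?_⟩
        rw [image_insert, hE, image_insert, hsym]
        exact insert_subset_insert _ (insert_subset_insert _ subset_union_left))
      (by rw [hT]; exact hstT)
    rw [hT] at h3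
    have h4 := ih ((D ∪ A ∪ B)ᶜ.card)
      (by
        rw [← hm]
        refine card_lt_card (compl_ssubset_compl.2 ⟨?_, fun h => he (h ?_)⟩)
        · exact subset_union_left.trans subset_union_left
        · simp [hA])
      (mem_union_left _ (mem_union_left _ hmid))
      (by
        rw [image_union, ← hDB, hB, image_mirror_image_mirror]
        exact union_right_comm _ _ _)
      hstT rfl
    linarith

/-! ### From values to strategies -/

theorem Position.isOver_iff (hn : 0 < n) (p : Position n) : p.IsOver ↔ p.drawn = univ := by
  constructor
  · intro h
    rw [eq_univ_iff_forall]
    intro e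
    obtain ⟨i, hi⟩ := exists_mem_sides hn e
    exact h i hi
  · intro h i
    rw [h]
    exact subset_univ _

/-- The margin that the first player can still secure. -/
noncomputable def Position.outcome (p : Position n) : ℤ :=
  p.score .first - p.score .second + if p.turn = .first then value p.drawn else -value p.drawn

theorem Position.outcome_draw (p : Position n) (e : Edge n) :
    (p.draw e).outcome = p.score .first - p.score .second +
      if p.turn = .first then margin p.drawn e else -margin p.drawn e := by
  have hcard := p.card_completedBy e
  have hne : (p.completedBy e).Nonempty ↔ ¬ completed (insert e p.drawn) = completed p.drawn := by
    rw [← card_pos]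
    omega
  unfold Position.outcome Position.draw margin
  by_cases h : completed (insert e p.drawn) = completed p.drawn
  · have h0 : (p.completedBy e).card = 0 := by omega
    cases hp : p.turn <;> simp [hne, h, h0, Player.other]
  · cases hp : p.turn <;> simp [hne, h, hcard] <;> ring

/-- The strategy draws an edge of maximal margin. This preserves `outcome`, and no move of the
opponent can lower it; at the end it is the difference of the scores. -/
theorem canGuaranteeTie_of_value_nonneg (hn : 0 < n) {s : Position n} (hs : s.turn = .first)
    (hscore : s.score .first = s.score .second) (hv : 0 ≤ value s.drawn) :
    CanGuaranteeTie .first s := by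
  have hex : ∀ p : Position n, ∃ e, ¬ p.IsOver → e ∉ p.drawn ∧ margin p.drawn e = value p.drawn := by
    intro p
    by_cases h : p.IsOver
    -- Arbitrary edge: no move is made once the game is over.
    · exact ⟨middle n, fun h' => (h' h).elim⟩
    · obtain ⟨e, he⟩ := exists_margin_eq_value fun hu => h ((p.isOver_iff hn).2 hu)
      exact ⟨e, fun _ => he⟩
  choose σ hσ using hex
  refine ⟨σ, fun p hp _ => (hσ p hp).1, fun q hq hover => ?_⟩
  have hinv : 0 ≤ q.outcome := by
    clear hover
    induction hq with
    | refl => simp [Position.outcome, hs, hscore, hv]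
    | tail _ hstep ih =>
      obtain ⟨hp, e, he, heσ, rfl⟩ := hstep
      rw [Position.outcome_draw]
      rw [Position.outcome] at ih
      split_ifs at ih ⊢ with ht
      · rw [heσ ht, (hσ _ hp).2]
        exact ih
      · linarith [margin_le_value he]
  have hu := (q.isOver_iff hn).1 hover
  simp only [Position.outcome, hu, value_univ, neg_zero, ite_self, add_zero] at hinv
  simp only [Player.other]
  omega

/-! ### The opening move -/

/-- Drawing the middle edge guarantees a tie if this makes the position symmetric and neither
completes a box nor leaves a box that misses exactly one side. -/
theorem value_nonneg_of_middle (heven : Even n) (hpos : 0 < n) {D : Finset (Edge n)}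
    (hmid : middle n ∉ D) (hsym : D.image mirror = D) (hst : Stable (insert (middle n) D))
    (hbottom : ∀ i : Fin n, Edge.bottom i ∉ D) : 0 ≤ value D := by
  have h1 := neg_value_le hmid (completed_eq (subset_insert _ _) fun i hi => by
    have := hi (show Edge.bottom i ∈ sides i by simp [mem_sides])
    simp [middle, hbottom] at this)
  have h2 := value_nonpos_of_symmetric heven hpos (mem_insert_self (middle n) D)
    (by rw [image_insert, hsym, mirror_middle heven]) hst
  linarith

/-- Every box lacks its bottom edge, and also an interior vertical one: `n ≥ 4` keeps `0`, `n / 2`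
and `n` from being consecutive. For `n = 2` this fails in the closed game. -/
theorem stable_insert_middle (hn : 4 ≤ n) {D : Finset (Edge n)}
    (hbottom : ∀ i : Fin n, Edge.bottom i ∉ D)
    (hvert : ∀ j : Fin (n + 1), Edge.vert j ∈ D → j = 0 ∨ j = Fin.last n) :
    Stable (insert (middle n) D) := by
  intro i f hi
  exfalso
  have h1 := hi (show Edge.bottom i ∈ sides i by simp [mem_sides])
  have h2 := hi (show Edge.vert i.castSucc ∈ sides i by simp [mem_sides])
  have h3 := hi (show Edge.vert i.succ ∈ sides i by simp [mem_sides])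
  have hf : f = Edge.bottom i := by
    simpa [middle, hbottom, eq_comm] using h1
  have hv : ∀ j : Fin (n + 1), Edge.vert j ∈ insert f (insert (middle n) D) →
      (j : ℕ) = n / 2 ∨ (j : ℕ) = 0 ∨ (j : ℕ) = n := by
    intro j hj
    rw [hf] at hj
    simp only [mem_insert, reduceCtorEq, false_or, middle, Edge.vert.injEq] at hj
    rcases hj with rfl | hj
    · simp
    · rcases hvert j hj with rfl | rfl <;> simp
  have h4 := hv _ h2
  have h5 := hv _ h3
  simp only [Fin.val_castSucc, Fin.val_succ] at h4 h5
  have := i.isLt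
  omega

end NarrowBoxes

open NarrowBoxes in
theorem theorem2 (n : ℕ) (hn : 4 ≤ n) (heven : Even n) :
    NarrowBoxes.CanGuaranteeTie NarrowBoxes.Player.first (NarrowBoxes.closedStart n) ∧
      NarrowBoxes.CanGuaranteeTie NarrowBoxes.Player.first (NarrowBoxes.openStart n) := by
  refine ⟨canGuaranteeTie_of_value_nonneg (by omega) rfl rfl ?_,
    canGuaranteeTie_of_value_nonneg (by omega) rfl rfl ?_⟩
  · refine value_nonneg_of_middle heven (by omega) ?_ ?_ (stable_insert_middle hn ?_ ?_) ?_
    · simp only [closedStart, middle, Finset.mem_insert, Edge.vert.injEq, Fin.ext_iff,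
        Finset.mem_image, Finset.mem_univ, true_and, reduceCtorEq, exists_false, or_false,
        Fin.val_zero, Fin.val_last]
      omega
    · simp only [closedStart, Finset.image_insert, Finset.image_image, mirror, Fin.rev_zero,
        Fin.rev_last]
      rw [Finset.insert_comm]
      congr 2
      ext e
      simp only [Finset.mem_image, Finset.mem_univ, true_and, Function.comp_apply, mirror]
      exact ⟨fun ⟨i, h⟩ => ⟨i.rev, h⟩, fun ⟨i, h⟩ => ⟨i.rev, by simpa using h⟩⟩
    · simp [closedStart]
    · simp [closedStart]
    · simp [closedStart]
  · exact value_nonneg_of_middle heven (by omega) (by simp [openStart]) (by simp [openStart])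
      (stable_insert_middle hn (by simp [openStart]) (by simp [openStart])) (by simp [openStart])
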